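/- Fix $d\ge 0$ and a reference point $x_0\in\mathbb R^d$. Let $\mathcal M(\mathbb R^d)$ be the set of finite positive Borel measures on $\mathbb R^d$ with finite second moment (including the zero measure) and $\mathcal P_2(\mathbb R^d)$ the set of probability measures with finite second moment, with the Wasserstein distance $W_2^2(\mu,\nu)=\inf_{\pi\in\Pi(\mu,\nu)}\int|x-y|^2\,d\pi(x,y)$, where $\Pi(\mu,\nu)$ is the set of measures on $\mathbb R^d\times\mathbb R^d$ with marginals $\mu$ and $\nu$. For $\mu\in\mathcal M(\mathbb R^d)$ let $m_\mu=\mu(\mathbb R^d)$, and let $\bar\mu=\mu/m_\mu$ if $m_\mu>0$ and $\bar\mu=\delta_{x_0}$ if $\mu=0$. Let $T_a(x)=a(x-x_0)+x_0$, and define $\mathrm{WOP}=\mathrm{WOP}_{x_0}$ by $$\mathrm{WOP}(\mu,\nu)^2=(m_\mu-m_\nu)^2+W_2^2\big((T_{m_\mu})_\#\bar\mu,(T_{m_\nu})_\#\bar\nu\big).$$ A (constant speed) geodesic from $x$ to $y$ for a distance $D$ is a path $(\sigma_t)_{t\in[0,1]}$ with $\sigma_0=x$, $\sigma_1=y$ and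 $D(\sigma_s,\sigma_t)=|t-s|\,D(x,y)$ for all $s,t\in[0,1]$. (i) Let $\mu_0,\mu_1\in\mathcal M(\mathbb R^d)$, with masses $m_0=m_{\mu_0}$ and $m_1=m_{\mu_1}$. A path $(\mu_t)_{t\in[0,1]}$ in $\mathcal M(\mathbb R^d)$ is a geodesic from $\mu_0$ to $\mu_1$ for $\mathrm{WOP}$ if and only if there is a geodesic $(\hat\mu_s)_{s\in[0,1]}$ from $\bar\mu_0$ to $\bar\mu_1$ in $(\mathcal P_2(\mathbb R^d),W_2)$ such that, for all $t\in[0,1]$, $$\mu_t=m_t\,\hat\mu_{\lambda_t},\qquad m_t=(1-t)m_0+t\,m_1,\qquad \lambda_t=\frac{t\,m_1}{(1-t)m_0+t\,m_1},$$ where $\mu_t=0$ whenever $m_t=0$. (ii) The geodesics do not depend on the reference point: for all $x_0,y_0\in\mathbb R^d$, a path is a geodesic from $\mu_0$ to $\mu_1$ for $\mathrm{WOP}_{x_0}$ if and only if it is one for $\mathrm{WOP}_{y_0}$. (iii) $(\mathcal M(\mathbb R^d),\mathrm{WOP})$ is a geodesic space, i.e. $\mathrm{WOP}$ is a metric on $\mathcal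 M(\mathbb R^d)$ and any two points are joined by a geodesic. (iv) It has nonnegative curvature in the sense of Alexandrov: for every geodesic $(\mu_t)_{t\in[0,1]}$ from $\mu_0$ to $\mu_1$, every $\eta\in\mathcal M(\mathbb R^d)$ and every $t\in[0,1]$, $$\mathrm{WOP}(\mu_t,\eta)^2\ \ge\ (1-t)\,\mathrm{WOP}(\mu_0,\eta)^2+t\,\mathrm{WOP}(\mu_1,\eta)^2-t(1-t)\,\mathrm{WOP}(\mu_0,\mu_1)^2.$$ -/

import Mathlib

open MeasureTheory

namespace WOPGeom

noncomputable section

/-- Euclidean space `ℝ^d`. -/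
abbrev E (d : ℕ) : Type := EuclideanSpace ℝ (Fin d)

/-- The set of finite positive Borel measures on `ℝ^d` with finite second moment
(the zero measure included). -/
def PosMeas (d : ℕ) : Type :=
  {μ : Measure (E d) // IsFiniteMeasure μ ∧ MemLp (fun x : E d => x) 2 μ}

/-- The set of Borel probability measures on `ℝ^d` with finite second moment. -/
def P2 (d : ℕ) : Type :=
  {μ : Measure (E d) // IsProbabilityMeasure μ ∧ MemLp (fun x : E d => x) 2 μ}

variable {d : ℕ}

/-- The total mass `m_μ`. -/
def mass (μ : PosMeas d) : ℝ := μ.1.real Set.univ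

/-- The set `Π(μ, ν)` of transport plans (couplings) between `μ` and `ν`. -/
def transportPlans (μ ν : Measure (E d)) : Set (Measure (E d × E d)) :=
  {π | π.map Prod.fst = μ ∧ π.map Prod.snd = ν}

/-- The optimal quadratic transport cost between `μ` and `ν`. -/
def transportCost (μ ν : Measure (E d)) : ENNReal :=
  ⨅ π ∈ transportPlans μ ν, ∫⁻ p, edist p.1 p.2 ^ 2 ∂π

/-- The Wasserstein distance `W₂` on `P2`.  The optimal cost is finite there, since the product
coupling has finite cost; its minimum is attained. -/
def W2 (μ ν : P2 d) : ℝ := Real.sqrt (transportCost μ.1 ν.1).toReal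

open Classical in
/-- The measure `μ / μ(ℝ^d)` if `μ ≠ 0`, and `δ_{x₀}` if `μ = 0`. -/
def normalizedMeasure (x₀ : E d) (μ : Measure (E d)) : Measure (E d) :=
  if μ = 0 then Measure.dirac x₀ else (μ Set.univ)⁻¹ • μ

theorem normalizedMeasure_mem (x₀ : E d) (μ : PosMeas d) :
    IsProbabilityMeasure (normalizedMeasure x₀ μ.1) ∧
      MemLp (fun x : E d => x) 2 (normalizedMeasure x₀ μ.1) := by
  obtain ⟨μ, hμ, h2⟩ := μ
  unfold normalizedMeasure
  split_ifs with h
  · refine ⟨inferInstance, ?_⟩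
    have hae : (fun x : E d => x) =ᵐ[Measure.dirac x₀] fun _ => x₀ := by
      rw [Filter.EventuallyEq, ae_dirac_eq]
      exact rfl
    exact (memLp_const x₀).ae_eq hae.symm
  · have h' : μ Set.univ ≠ 0 := by simpa using h
    refine ⟨⟨?_⟩, ?_⟩
    · simpa using ENNReal.inv_mul_cancel h' (measure_ne_top μ _)
    · exact h2.smul_measure (ENNReal.inv_ne_top.2 h')

/-- The normalization `μ̄` of `μ`, as an element of `P2`. -/
def normalized (x₀ : E d) (μ : PosMeas d) : P2 d :=
  ⟨normalizedMeasure x₀ μ.1, normalizedMeasure_mem x₀ μ⟩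

/-- The dilation `T_a(x) = a (x - x₀) + x₀` with centre `x₀`. -/
def dilation (x₀ : E d) (a : ℝ) (x : E d) : E d := a • (x - x₀) + x₀

theorem measurable_dilation (x₀ : E d) (a : ℝ) : Measurable (dilation x₀ a) := by
  unfold dilation
  fun_prop

theorem map_dilation_mem (x₀ : E d) (a : ℝ) (μ : P2 d) :
    IsProbabilityMeasure (μ.1.map (dilation x₀ a)) ∧
      MemLp (fun x : E d => x) 2 (μ.1.map (dilation x₀ a)) := by
  obtain ⟨μ, hμ, h2⟩ := μ
  have hm := (measurable_dilation x₀ a).aemeasurable (μ := μ)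
  refine ⟨Measure.isProbabilityMeasure_map hm, ?_⟩
  refine (memLp_map_measure_iff (g := fun x : E d => x) aestronglyMeasurable_id hm).2 ?_
  exact ((h2.sub (memLp_const x₀)).const_smul a).add (memLp_const x₀)

/-- The pushforward `T_a # μ`, as an element of `P2`. -/
def dilate (x₀ : E d) (a : ℝ) (μ : P2 d) : P2 d :=
  ⟨μ.1.map (dilation x₀ a), map_dilation_mem x₀ a μ⟩

/-- The Wasserstein On Positive measures distance with reference point `x₀`. -/
def WOP (x₀ : E d) (μ ν : PosMeas d) : ℝ :=
  Real.sqrt ((mass μ - mass ν) ^ 2 +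
    W2 (dilate x₀ (mass μ) (normalized x₀ μ)) (dilate x₀ (mass ν) (normalized x₀ ν)) ^ 2)

/-- `D` is a metric on `X`. -/
structure IsMetric {X : Type*} (D : X → X → ℝ) : Prop where
  eq_zero_iff : ∀ x y, D x y = 0 ↔ x = y
  symm : ∀ x y, D x y = D y x
  triangle : ∀ x y z, D x z ≤ D x y + D y z

/-- `σ`, restricted to `[0, 1]`, is a constant speed geodesic from `x` to `y` for `D`. -/
structure IsGeodesic {X : Type*} (D : X → X → ℝ) (x y : X) (σ : ℝ → X) : Prop where
  left : σ 0 = x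
  right : σ 1 = y
  dist_eq : ∀ s ∈ Set.Icc (0 : ℝ) 1, ∀ t ∈ Set.Icc (0 : ℝ) 1, D (σ s) (σ t) = |t - s| * D x y

/-- `(X, D)` is a geodesic metric space. -/
def IsGeodesicSpace {X : Type*} (D : X → X → ℝ) : Prop :=
  IsMetric D ∧ ∀ x y, ∃ σ, IsGeodesic D x y σ

/-- `(X, D)` is a geodesic metric space with nonnegative curvature in the sense of Alexandrov:
the distance from any point to a geodesic is at least the distance in the Euclidean comparison
triangle. -/
def IsNonnegativelyCurved {X : Type*} (D : X → X → ℝ) : Prop :=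
  IsGeodesicSpace D ∧
    ∀ (x y z : X) (σ : ℝ → X), IsGeodesic D x y σ → ∀ t ∈ Set.Icc (0 : ℝ) 1,
      (1 - t) * D x z ^ 2 + t * D y z ^ 2 - t * (1 - t) * D x y ^ 2 ≤ D (σ t) z ^ 2

/-- The interpolated mass `m_t = (1 - t) m₀ + t m₁`. -/
def interpMass (m₀ m₁ t : ℝ) : ℝ := (1 - t) * m₀ + t * m₁

/-- The time change `λ_t = t m₁ / ((1 - t) m₀ + t m₁)`.  If the denominator vanishes the value is
irrelevant, because the interpolated mass is then zero. -/
def timeChange (m₀ m₁ t : ℝ) : ℝ := t * m₁ / interpMass m₀ m₁ t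

end

end WOPGeom

/-!
The space of positive measures with the distance `WOP` embeds, through the mass `m` and the spatial
part `(T_m)_# μ̄`, into the `ℓ²` product of the line and the Wasserstein space.  Equality in
Minkowski's inequality (`IsGeodesic.of_sq_eq_add`) splits a geodesic of such a product into its
components: the mass is affine in time and the spatial part is a Wasserstein geodesic.

It remains to undo the dilations.  For random vectors `X`, `Y` in a Hilbert space `L²`, centred at
the reference point, `|aX - bY|² = ab |X - Y|² + a(a - b) |X|² + b(b - a) |Y|²`, so optimal plans
stay optimal under dilations and `W2_dilate_sq` expresses the distance of dilated measures through
the distance and the second moments of the original ones.  The second moment along a Wasserstein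
geodesic is the same quadratic function of time as along a segment in `L²`
(`IsGeodesic.W2_dirac_sq`).  Hence all distances along the path of spatial parts determine all
distances along the path of normalizations and conversely, and the constant speed conditions for
the two paths turn into each other under the time change `λ`.  When one endpoint is the zero
measure, the time change is constant while the mass is positive, and the normalization is constant.

The facts about the Wasserstein space come from representing measures as laws of elements of `L²`.
Optimal plans exist because the set of plans is compact by Prokhorov's theorem and the cost is lower
semicontinuous.  Gluing three optimal plans along a common marginal (`exists_star`) places four
measures in the same `L²` space with three prescribed distances.  Strict convexity of `L²` then
shows that an intermediate measure of a geodesic is the law of the interpolation of an optimal pair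
(`IsGeodesic.exists_lineMap`), which gives the second moments and, by Stewart's identity in `L²`,
the nonnegative curvature.  For `WOP` the curvature inequality is the sum of the one for the
spatial parts and the equality for the masses.
-/

open MeasureTheory

namespace WOPGeom

variable {d : ℕ}

/-! ### Optimal transport plans -/

/-- Truncating the cost at height `n` gives a bounded continuous function, so the cost is a supremum
of weakly continuous functionals. -/
theorem lowerSemicontinuous_lintegral_edist_sq :
    LowerSemicontinuous fun π : ProbabilityMeasure (E d × E d) =>
      ∫⁻ p, edist p.1 p.2 ^ 2 ∂(π : Measure (E d × E d)) := by
  let F : ℕ → BoundedContinuousFunction (E d × E d) NNReal := fun n =>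
    BoundedContinuousFunction.mkOfBound ⟨fun p => min (nndist p.1 p.2 ^ 2) n, by fun_prop⟩ n <| by
      intro p q
      have hp : ((min (nndist p.1 p.2 ^ 2) n : NNReal) : ℝ) ≤ n := by
        exact_mod_cast min_le_right _ _
      have hq : ((min (nndist q.1 q.2 ^ 2) n : NNReal) : ℝ) ≤ n := by
        exact_mod_cast min_le_right _ _
      exact abs_sub_le_of_nonneg_of_le (NNReal.coe_nonneg _) hp (NNReal.coe_nonneg _) hq
  have hF : ∀ n p, ((F n p : NNReal) : ENNReal) = min (edist p.1 p.2 ^ 2) n := by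
    intro n p
    have : F n p = min (nndist p.1 p.2 ^ 2) n := rfl
    rw [this, edist_nndist]
    push_cast
    rfl
  have h : ∀ π : ProbabilityMeasure (E d × E d),
      ∫⁻ p, edist p.1 p.2 ^ 2 ∂(π : Measure (E d × E d)) =
        ⨆ n, ∫⁻ p, F n p ∂(π : Measure (E d × E d)) := by
    intro π
    rw [← lintegral_iSup]
    · refine lintegral_congr fun p => ?_
      simp only [hF]
      rw [← inf_iSup_eq, ENNReal.iSup_natCast, inf_top_eq]
    · intro n
      exact ((F n).continuous.measurable).coe_nnreal_ennreal
    · intro n m hnm p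
      simp only [hF]
      gcongr
  simp only [h]
  refine lowerSemicontinuous_iSup fun n => Continuous.lowerSemicontinuous ?_
  rw [continuous_iff_continuousAt]
  intro π
  exact ProbabilityMeasure.tendsto_iff_forall_lintegral_tendsto.1 Filter.tendsto_id (F n)

/-- Plans with fixed marginals form a closed and tight set. -/
theorem isCompact_transportPlans (μ ν : ProbabilityMeasure (E d)) :
    IsCompact {π : ProbabilityMeasure (E d × E d) |
      (π : Measure (E d × E d)) ∈ transportPlans (μ : Measure (E d)) ν} := by
  set S := {π : ProbabilityMeasure (E d × E d) |
      (π : Measure (E d × E d)) ∈ transportPlans (μ : Measure (E d)) ν} with hS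
  have hclosed : IsClosed S := by
    have h1 : IsClosed {π : ProbabilityMeasure (E d × E d) |
        π.map measurable_fst.aemeasurable = μ} :=
      isClosed_eq (ProbabilityMeasure.continuous_map continuous_fst) continuous_const
    have h2 : IsClosed {π : ProbabilityMeasure (E d × E d) |
        π.map measurable_snd.aemeasurable = ν} :=
      isClosed_eq (ProbabilityMeasure.continuous_map continuous_snd) continuous_const
    convert h1.inter h2 using 1
    ext π
    exact and_congr (Subtype.ext_iff (a1 := π.map measurable_fst.aemeasurable) (a2 := μ)).symm
      (Subtype.ext_iff (a1 := π.map measurable_snd.aemeasurable) (a2 := ν)).symm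
  rw [← hclosed.closure_eq]
  refine isCompact_closure_of_isTightMeasureSet (IsTightMeasureSet.prodMk ?_ ?_)
  · refine (isTightMeasureSet_singleton (μ := (μ : Measure (E d)))).subset ?_
    rintro _ ⟨_, ⟨π, hπ, rfl⟩, rfl⟩
    exact hπ.1
  · refine (isTightMeasureSet_singleton (μ := (ν : Measure (E d)))).subset ?_
    rintro _ ⟨_, ⟨π, hπ, rfl⟩, rfl⟩
    exact hπ.2

theorem exists_optimal_transportPlan (μ ν : Measure (E d)) [IsProbabilityMeasure μ]
    [IsProbabilityMeasure ν] :
    ∃ π ∈ transportPlans μ ν, ∫⁻ p, edist p.1 p.2 ^ 2 ∂π = transportCost μ ν := by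
  obtain ⟨π, hπ, hmin⟩ := LowerSemicontinuousOn.exists_isMinOn
    ⟨⟨μ.prod ν, inferInstance⟩,
      show μ.prod ν ∈ transportPlans μ ν by simp [transportPlans]⟩
    (isCompact_transportPlans ⟨μ, inferInstance⟩ ⟨ν, inferInstance⟩)
    (lowerSemicontinuous_lintegral_edist_sq.lowerSemicontinuousOn _)
  refine ⟨π, hπ, le_antisymm (le_iInf₂ fun ρ hρ => ?_)
    (iInf₂_le (π : Measure (E d × E d)) hπ)⟩
  have : IsProbabilityMeasure (ρ.map Prod.fst) := by rw [hρ.1]; infer_instance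
  have hρp : IsProbabilityMeasure ρ :=
    Measure.isProbabilityMeasure_of_map Prod.fst
  exact hmin (a := ⟨ρ, hρp⟩) hρ

/-- The gluing lemma: a random variable `Y` can be added to a probability space carrying `Z` so that
`(Z, Y)` has a prescribed joint law `π`.  The conditional law of `Y` is that of `π` given the value
of `Z`. -/
theorem exists_gluing {Ω : Type*} [MeasurableSpace Ω] (P : Measure Ω) [IsProbabilityMeasure P]
    {Z : Ω → E d} (hZ : Measurable Z) (π : Measure (E d × E d)) (hπ : π.map Prod.fst = P.map Z) :
    ∃ Q : Measure (Ω × E d), Q.map Prod.fst = P ∧ Q.map (fun q => (Z q.1, q.2)) = π := by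
  have : IsProbabilityMeasure (π.map Prod.fst) := by
    rw [hπ]; exact Measure.isProbabilityMeasure_map hZ.aemeasurable
  have hπp : IsProbabilityMeasure π := Measure.isProbabilityMeasure_of_map Prod.fst
  refine ⟨P.compProd (π.condKernel.comap Z hZ), Measure.fst_compProd _ _, ?_⟩
  conv_rhs => rw [← π.disintegrate π.condKernel]
  have hfst : π.fst = P.map Z := hπ
  refine Measure.ext_of_lintegral _ fun f hf => ?_
  rw [lintegral_map hf (by fun_prop), Measure.lintegral_compProd (by fun_prop),
    Measure.lintegral_compProd hf, hfst, lintegral_map (by fun_prop) hZ]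
  rfl

/-! ### Square-integrable random vectors and their laws -/

noncomputable section

/-- The law of a square-integrable random vector. -/
def law {Ω : Type*} [MeasurableSpace Ω] {P : Measure Ω} [IsProbabilityMeasure P]
    (f : Lp (E d) 2 P) : P2 d :=
  ⟨P.map f, Measure.isProbabilityMeasure_map (Lp.aestronglyMeasurable f).aemeasurable,
    (memLp_map_measure_iff (g := fun x : E d => x) aestronglyMeasurable_id
      (Lp.aestronglyMeasurable f).aemeasurable).2 (Lp.memLp f)⟩

/-- The Dirac mass at `c`, as an element of `P2`. -/
def diracP2 (c : E d) : P2 d :=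
  ⟨Measure.dirac c, inferInstance,
    (memLp_const c).ae_eq (by rw [Filter.EventuallyEq, ae_dirac_eq]; exact rfl)⟩

end

section

variable {Ω : Type*} [MeasurableSpace Ω] {P : Measure Ω}

theorem lintegral_edist_sq (f g : Lp (E d) 2 P) :
    ∫⁻ ω, edist (f ω) (g ω) ^ 2 ∂P = edist f g ^ 2 := by
  have h := eLpNorm_nnreal_pow_eq_lintegral (μ := P) (f := (f : Ω → E d) - (g : Ω → E d)) (p := 2) two_ne_zero
  simp only [NNReal.coe_ofNat, ENNReal.rpow_ofNat, ENNReal.coe_ofNat] at h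
  rw [Lp.edist_def, h]
  simp only [edist_eq_enorm_sub, Pi.sub_apply]

theorem sqrt_edist_sq_toReal (f g : Lp (E d) 2 P) :
    √((edist f g ^ 2).toReal) = dist f g := by
  rw [ENNReal.toReal_pow, ← dist_edist, Real.sqrt_sq dist_nonneg]

theorem memLp_of_map_eq {X : Ω → E d} (hX : Measurable X) {μ : P2 d} (h : P.map X = μ.1) :
    MemLp X 2 P := by
  refine (memLp_map_measure_iff (g := fun x : E d => x) aestronglyMeasurable_id
    hX.aemeasurable).1 ?_
  rw [h]
  exact μ.2.2

theorem dist_toLp_eq_W2 {X Y : Ω → E d} (hX : MemLp X 2 P) (hY : MemLp Y 2 P) {μ ν : P2 d}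
    (h : ∫⁻ ω, edist (X ω) (Y ω) ^ 2 ∂P = transportCost μ.1 ν.1) :
    dist (hX.toLp X) (hY.toLp Y) = W2 μ ν := by
  rw [W2, ← h, ← sqrt_edist_sq_toReal, ← lintegral_edist_sq]
  congr 2
  refine lintegral_congr_ae ?_
  filter_upwards [hX.coeFn_toLp, hY.coeFn_toLp] with ω h1 h2
  rw [h1, h2]

variable [IsProbabilityMeasure P]

theorem transportCost_law_le (f g : Lp (E d) 2 P) :
    transportCost (law f).1 (law g).1 ≤ edist f g ^ 2 := by
  have hf := (Lp.aestronglyMeasurable f).aemeasurable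
  have hg := (Lp.aestronglyMeasurable g).aemeasurable
  have hfg := hf.prodMk hg
  have hplan : P.map (fun ω => (f ω, g ω)) ∈ transportPlans (law f).1 (law g).1 :=
    ⟨AEMeasurable.map_map_of_aemeasurable measurable_fst.aemeasurable hfg,
      AEMeasurable.map_map_of_aemeasurable measurable_snd.aemeasurable hfg⟩
  refine (iInf₂_le (P.map fun ω => (f ω, g ω)) hplan).trans ?_
  rw [lintegral_map' (by fun_prop) hfg, lintegral_edist_sq]

theorem W2_law_le_dist (f g : Lp (E d) 2 P) : W2 (law f) (law g) ≤ dist f g := by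
  rw [← sqrt_edist_sq_toReal, W2]
  exact Real.sqrt_le_sqrt (ENNReal.toReal_mono (ENNReal.pow_ne_top (edist_ne_top f g))
    (transportCost_law_le f g))

theorem law_toLp {X : Ω → E d} (hX : MemLp X 2 P) {μ : P2 d} (h : P.map X = μ.1) :
    law (hX.toLp X) = μ :=
  Subtype.ext ((Measure.map_congr hX.coeFn_toLp).trans h)

/-- A random vector of law `μ` that is optimally coupled with a given one can be adjoined to a
probability space. -/
theorem exists_adjoin_optimal {Z : Ω → E d} (hZ : Measurable Z) (ζ μ : P2 d) (h : P.map Z = ζ.1) :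
    ∃ Q : Measure (Ω × E d), IsProbabilityMeasure Q ∧ Q.map Prod.fst = P ∧ Q.map Prod.snd = μ.1 ∧
      ∫⁻ q, edist (Z q.1) q.2 ^ 2 ∂Q = transportCost ζ.1 μ.1 := by
  have := ζ.2.1
  have := μ.2.1
  obtain ⟨π, hπ, hopt⟩ := exists_optimal_transportPlan ζ.1 μ.1
  obtain ⟨Q, hQ1, hQ2⟩ := exists_gluing P hZ π (hπ.1.trans h.symm)
  have : IsProbabilityMeasure (Q.map Prod.fst) := by rw [hQ1]; infer_instance
  refine ⟨Q, Measure.isProbabilityMeasure_of_map Prod.fst, hQ1, ?_, ?_⟩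
  · rw [← hπ.2, ← hQ2, Measure.map_map (by fun_prop) (by fun_prop)]
    rfl
  · rw [← hopt, ← hQ2, lintegral_map (by fun_prop) (by fun_prop)]

end

/-- Three measures can be optimally coupled with a fourth one simultaneously. -/
theorem exists_star (ζ μ ν η : P2 d) :
    ∃ (P : Measure (((E d × E d) × E d) × E d)) (_ : IsProbabilityMeasure P)
      (z x y h : Lp (E d) 2 P), law z = ζ ∧ law x = μ ∧ law y = ν ∧ law h = η ∧
        dist z x = W2 ζ μ ∧ dist z y = W2 ζ ν ∧ dist z h = W2 ζ η := by
  have := ζ.2.1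
  obtain ⟨P₁, hP₁, hz₁, hx₁, hc₁⟩ :=
    exists_adjoin_optimal (P := ζ.1) measurable_id ζ μ Measure.map_id
  have hz₁' : P₁.map (fun q => q.1) = ζ.1 := hz₁
  obtain ⟨P₂, hP₂, h₂, hy₂, hc₂⟩ := exists_adjoin_optimal (P := P₁) measurable_fst ζ ν hz₁'
  have hz₂ : P₂.map (fun q => q.1.1) = ζ.1 := by
    rw [← hz₁', ← h₂, Measure.map_map (by fun_prop) (by fun_prop)]; rfl
  obtain ⟨P, hP, h₃, hh₃, hc₃⟩ := exists_adjoin_optimal (P := P₂) (by fun_prop) ζ η hz₂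
  have hz : P.map (fun q => q.1.1.1) = ζ.1 := by
    rw [← hz₂, ← h₃, Measure.map_map (by fun_prop) (by fun_prop)]; rfl
  have hx : P.map (fun q => q.1.1.2) = μ.1 := by
    rw [← hx₁, ← h₂, ← h₃, Measure.map_map (by fun_prop) (by fun_prop),
      Measure.map_map (by fun_prop) (by fun_prop)]; rfl
  have hy : P.map (fun q => q.1.2) = ν.1 := by
    rw [← hy₂, ← h₃, Measure.map_map (by fun_prop) (by fun_prop)]; rfl
  have hh : P.map (fun q => q.2) = η.1 := hh₃
  refine ⟨P, hP, (memLp_of_map_eq (by fun_prop) hz).toLp _,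
    (memLp_of_map_eq (by fun_prop) hx).toLp _, (memLp_of_map_eq (by fun_prop) hy).toLp _,
    (memLp_of_map_eq (by fun_prop) hh).toLp _, law_toLp _ hz, law_toLp _ hx, law_toLp _ hy,
    law_toLp _ hh, dist_toLp_eq_W2 _ _ ?_, dist_toLp_eq_W2 _ _ ?_, dist_toLp_eq_W2 _ _ hc₃⟩
  · rw [← hc₁, ← h₂, ← h₃, lintegral_map (by fun_prop) (by fun_prop),
      lintegral_map (by fun_prop) (by fun_prop)]
    rfl
  · rw [← hc₂, ← h₃, lintegral_map (by fun_prop) (by fun_prop)]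

/-- Optimal transport plans, in terms of random vectors. -/
theorem exists_dist_eq_W2 (μ ν : P2 d) :
    ∃ (P : Measure (((E d × E d) × E d) × E d)) (_ : IsProbabilityMeasure P)
      (x y : Lp (E d) 2 P), law x = μ ∧ law y = ν ∧ dist x y = W2 μ ν := by
  obtain ⟨P, hP, z, x, y, h, hz, hx, -, -, hd, -⟩ := exists_star μ ν ν ν
  exact ⟨P, hP, z, x, hz, hx, hd⟩

/-! ### The Wasserstein space -/

theorem W2_nonneg (μ ν : P2 d) : 0 ≤ W2 μ ν := Real.sqrt_nonneg _

theorem W2_self (μ : P2 d) : W2 μ μ = 0 := by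
  obtain ⟨P, hP, x, -, rfl, -⟩ := exists_dist_eq_W2 μ μ
  exact le_antisymm ((W2_law_le_dist x x).trans (dist_self x).le) (W2_nonneg _ _)

theorem W2_comm (μ ν : P2 d) : W2 μ ν = W2 ν μ := by
  have key : ∀ μ ν : P2 d, W2 ν μ ≤ W2 μ ν := by
    intro μ ν
    obtain ⟨P, hP, x, y, rfl, rfl, h⟩ := exists_dist_eq_W2 μ ν
    rw [← h, dist_comm]
    exact W2_law_le_dist y x
  exact le_antisymm (key ν μ) (key μ ν)

theorem W2_triangle (μ ζ ν : P2 d) : W2 μ ν ≤ W2 μ ζ + W2 ζ ν := by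
  obtain ⟨P, hP, z, x, y, h, rfl, rfl, rfl, -, hx, hy, -⟩ := exists_star ζ μ ν ν
  rw [W2_comm (law x) (law z), ← hx, ← hy, dist_comm z x]
  exact (W2_law_le_dist x y).trans (dist_triangle x z y)

theorem W2_eq_zero_iff (μ ν : P2 d) : W2 μ ν = 0 ↔ μ = ν := by
  refine ⟨fun h => ?_, fun h => h ▸ W2_self μ⟩
  obtain ⟨P, hP, x, y, rfl, rfl, hd⟩ := exists_dist_eq_W2 μ ν
  rw [dist_eq_zero.1 (hd.trans h)]

/-- The laws of the interpolations of an optimally coupled pair of random vectors form a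
geodesic. -/
theorem exists_isGeodesic_W2 (μ ν : P2 d) : ∃ σ, IsGeodesic W2 μ ν σ := by
  obtain ⟨P, hP, x, y, rfl, rfl, hd⟩ := exists_dist_eq_W2 μ ν
  let σ : ℝ → P2 d := fun t => law (AffineMap.lineMap x y t)
  have h0 : σ 0 = law x := by simp [σ]
  have h1 : σ 1 = law y := by simp [σ]
  have hle : ∀ s t, W2 (σ s) (σ t) ≤ |t - s| * W2 (law x) (law y) := by
    intro s t
    refine (W2_law_le_dist _ _).trans_eq ?_
    rw [dist_lineMap_lineMap, hd, dist_comm, Real.dist_eq]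
  refine ⟨σ, h0, h1, ?_⟩
  have key : ∀ s ∈ Set.Icc (0 : ℝ) 1, ∀ t ∈ Set.Icc (0 : ℝ) 1, s ≤ t →
      W2 (σ s) (σ t) = |t - s| * W2 (law x) (law y) := by
    intro s hs t ht hst
    refine le_antisymm (hle s t) ?_
    have e1 := hle 0 s
    have e2 := hle t 1
    have e3 := W2_triangle (σ 0) (σ s) (σ 1)
    have e4 := W2_triangle (σ s) (σ t) (σ 1)
    rw [abs_of_nonneg (by linarith [hs.1])] at e1
    rw [abs_of_nonneg (by linarith [ht.2])] at e2
    rw [abs_of_nonneg (by linarith)]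
    rw [← h0, ← h1] at *
    linarith
  intro s hs t ht
  rcases le_total s t with h | h
  · exact key s hs t ht h
  · rw [W2_comm, abs_sub_comm]
    exact key t ht s hs h

/-- Along a Wasserstein geodesic, the intermediate measure is the law of the interpolation of an
optimally coupled pair of random vectors.  These live on a space that also carries a random vector
of law `η` optimally coupled with the interpolation. -/
theorem IsGeodesic.exists_lineMap {μ ν : P2 d} {σ : ℝ → P2 d} (hσ : IsGeodesic W2 μ ν σ) {t : ℝ}
    (ht : t ∈ Set.Icc (0 : ℝ) 1) (η : P2 d) :
    ∃ (P : Measure (((E d × E d) × E d) × E d)) (_ : IsProbabilityMeasure P)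
      (x y h : Lp (E d) 2 P), law x = μ ∧ law y = ν ∧ law h = η ∧
        law (AffineMap.lineMap x y t) = σ t ∧ dist x y = W2 μ ν ∧
        dist (AffineMap.lineMap x y t) h = W2 (σ t) η := by
  obtain ⟨P, hP, z, x, y, h, hz, hx, hy, hh, dx, dy, dh⟩ := exists_star (σ t) μ ν η
  have ex : dist x z = t * W2 μ ν := by
    rw [dist_comm, dx, W2_comm]
    have := hσ.dist_eq 0 (by simp) t ht
    rwa [hσ.left, sub_zero, abs_of_nonneg ht.1] at this
  have ey : dist z y = (1 - t) * W2 μ ν := by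
    rw [dy]
    have := hσ.dist_eq t ht 1 (by simp)
    rwa [hσ.right, abs_of_nonneg (by linarith [ht.2])] at this
  have exy : dist x y = W2 μ ν := by
    refine le_antisymm ?_ (by rw [← hx, ← hy]; exact W2_law_le_dist x y)
    linarith [dist_triangle x z y]
  have hzl : z = AffineMap.lineMap x y t :=
    eq_lineMap_of_dist_eq_mul_of_dist_eq_mul (by rw [exy, ex]) (by rw [exy, ey])
  exact ⟨P, hP, x, y, h, hx, hy, hh, hzl ▸ hz, exy, hzl ▸ dh⟩

/-- Stewart's identity: the distance from a point to a segment in a Hilbert space. -/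
theorem dist_lineMap_sq {H : Type*} [NormedAddCommGroup H] [InnerProductSpace ℝ H] (x y h : H)
    (t : ℝ) : dist (AffineMap.lineMap x y t) h ^ 2 =
      (1 - t) * dist x h ^ 2 + t * dist y h ^ 2 - t * (1 - t) * dist x y ^ 2 := by
  have e1 : AffineMap.lineMap x y t - h = (1 - t) • (x - h) + t • (y - h) := by
    rw [AffineMap.lineMap_apply_module]; module
  have e2 : x - y = (x - h) - (y - h) := by abel
  rw [dist_eq_norm, dist_eq_norm, dist_eq_norm, dist_eq_norm, e1, e2, norm_add_sq_real,
    norm_sub_sq_real (x - h) (y - h), norm_smul, norm_smul, real_inner_smul_left, real_inner_smul_right, mul_pow,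
    mul_pow, Real.norm_eq_abs, Real.norm_eq_abs, sq_abs, sq_abs]
  ring

/-- The Wasserstein space has nonnegative curvature. -/
theorem W2_comparison {μ ν : P2 d} {σ : ℝ → P2 d} (hσ : IsGeodesic W2 μ ν σ) {t : ℝ}
    (ht : t ∈ Set.Icc (0 : ℝ) 1) (η : P2 d) :
    (1 - t) * W2 μ η ^ 2 + t * W2 ν η ^ 2 - t * (1 - t) * W2 μ ν ^ 2 ≤ W2 (σ t) η ^ 2 := by
  obtain ⟨P, hP, x, y, h, rfl, rfl, rfl, -, hxy, hd⟩ := hσ.exists_lineMap ht η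
  rw [← hd, ← hxy, dist_lineMap_sq]
  have h0 := W2_nonneg (law x) (law h)
  have h0' := W2_nonneg (law y) (law h)
  have h1 := W2_law_le_dist x h
  have h2 := W2_law_le_dist y h
  have := ht.1
  have : 0 ≤ 1 - t := by linarith [ht.2]
  gcongr

section

variable {Ω : Type*} [MeasurableSpace Ω] {P : Measure Ω} [IsProbabilityMeasure P]

theorem law_const (c : E d) : law (Lp.const 2 P c) = diracP2 c := by
  refine Subtype.ext ((Measure.map_congr (Lp.coeFn_const 2 P c)).trans ?_)
  exact (Measure.map_const P c).trans (by simp [diracP2])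

theorem ae_eq_of_law_eq_dirac {g : Lp (E d) 2 P} {c : E d} (h : law g = diracP2 c) :
    ∀ᵐ ω ∂P, g ω = c := by
  have h' : P.map g = Measure.dirac c := congrArg Subtype.val h
  refine ae_of_ae_map (p := fun x => x = c) (Lp.aestronglyMeasurable g).aemeasurable ?_
  rw [h', ae_dirac_eq]
  exact rfl

/-- The only coupling with a Dirac mass is the product. -/
theorem edist_sq_of_law_eq_dirac (f : Lp (E d) 2 P) {g : Lp (E d) 2 P} {c : E d}
    (h : law g = diracP2 c) : edist f g ^ 2 = ∫⁻ x, edist x c ^ 2 ∂(law f).1 := by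
  have e : (law f).1 = P.map f := rfl
  rw [← lintegral_edist_sq, e,
    lintegral_map' (by fun_prop) (Lp.aestronglyMeasurable f).aemeasurable]
  refine lintegral_congr_ae ?_
  filter_upwards [ae_eq_of_law_eq_dirac h] with ω hω
  rw [hω]

theorem W2_law_dirac (f : Lp (E d) 2 P) (c : E d) :
    W2 (law f) (diracP2 c) = dist f (Lp.const 2 P c) := by
  obtain ⟨P', hP', x, y, hx, hy, hd⟩ := exists_dist_eq_W2 (law f) (diracP2 c)
  rw [← hd, ← sqrt_edist_sq_toReal, ← sqrt_edist_sq_toReal, edist_sq_of_law_eq_dirac x hy, hx,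
    edist_sq_of_law_eq_dirac f (law_const c)]

end

/-! ### Second moments and dilations -/

/-- The second moment about `c`, which is the squared distance to `δ_c`, along a Wasserstein
geodesic. -/
theorem IsGeodesic.W2_dirac_sq {μ ν : P2 d} {σ : ℝ → P2 d} (hσ : IsGeodesic W2 μ ν σ) {t : ℝ}
    (ht : t ∈ Set.Icc (0 : ℝ) 1) (c : E d) :
    W2 (σ t) (diracP2 c) ^ 2 = (1 - t) * W2 μ (diracP2 c) ^ 2 + t * W2 ν (diracP2 c) ^ 2 -
      t * (1 - t) * W2 μ ν ^ 2 := by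
  obtain ⟨P, hP, x, y, -, rfl, rfl, -, hl, hxy, -⟩ := hσ.exists_lineMap ht μ
  rw [← hl, W2_law_dirac, W2_law_dirac, W2_law_dirac, dist_lineMap_sq, hxy]

theorem law_lineMap_const {Ω : Type*} [MeasurableSpace Ω] {P : Measure Ω} [IsProbabilityMeasure P]
    (c : E d) (f : Lp (E d) 2 P) (a : ℝ) :
    law (AffineMap.lineMap (Lp.const 2 P c) f a) = dilate c a (law f) := by
  refine Subtype.ext ?_
  change P.map _ = (P.map f).map (dilation c a)
  rw [AEMeasurable.map_map_of_aemeasurable (measurable_dilation c a).aemeasurable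
    (Lp.aestronglyMeasurable f).aemeasurable, AffineMap.lineMap_apply_module']
  refine Measure.map_congr ?_
  filter_upwards [Lp.coeFn_add (a • (f - Lp.const 2 P c)) (Lp.const 2 P c),
    Lp.coeFn_smul a (f - Lp.const 2 P c), Lp.coeFn_sub f (Lp.const 2 P c),
    Lp.coeFn_const 2 P c] with ω h1 h2 h3 h4
  simp only [h1, h2, h3, h4, Pi.add_apply, Pi.smul_apply, Pi.sub_apply, Function.const_apply,
    Function.comp_apply, dilation]

theorem dist_lineMap_lineMap_sq {H : Type*} [NormedAddCommGroup H] [InnerProductSpace ℝ H]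
    (c x y : H) (a b : ℝ) :
    dist (AffineMap.lineMap c x a) (AffineMap.lineMap c y b) ^ 2 =
      a * b * dist x y ^ 2 + a * (a - b) * dist x c ^ 2 + b * (b - a) * dist y c ^ 2 := by
  have e1 : AffineMap.lineMap c x a - AffineMap.lineMap c y b = a • (x - c) - b • (y - c) := by
    rw [AffineMap.lineMap_apply_module, AffineMap.lineMap_apply_module]; module
  have e2 : x - y = (x - c) - (y - c) := by abel
  rw [dist_eq_norm, dist_eq_norm, dist_eq_norm, dist_eq_norm, e1, e2, norm_sub_sq_real,
    norm_sub_sq_real (x - c) (y - c), norm_smul, norm_smul, real_inner_smul_left,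
    real_inner_smul_right, mul_pow, mul_pow, Real.norm_eq_abs, Real.norm_eq_abs, sq_abs, sq_abs]
  ring

theorem dilate_zero (c : E d) (μ : P2 d) : dilate c 0 μ = diracP2 c := by
  have := μ.2.1
  refine Subtype.ext ?_
  have : dilation c 0 = fun _ => c := by ext1 x; simp [dilation]
  change μ.1.map _ = Measure.dirac c
  rw [this, Measure.map_const]
  simp

theorem dilate_inv_dilate (c : E d) {a : ℝ} (ha : a ≠ 0) (μ : P2 d) :
    dilate c a⁻¹ (dilate c a μ) = μ := by
  refine Subtype.ext ?_
  change (μ.1.map _).map _ = μ.1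
  rw [Measure.map_map (measurable_dilation _ _) (measurable_dilation _ _)]
  have : dilation c a⁻¹ ∘ dilation c a = id := by
    ext1 x
    simp [dilation, smul_smul, inv_mul_cancel₀ ha]
  rw [this, Measure.map_id]

theorem W2_dilate_dirac_sq (c : E d) (a : ℝ) (μ : P2 d) :
    W2 (dilate c a μ) (diracP2 c) ^ 2 = a ^ 2 * W2 μ (diracP2 c) ^ 2 := by
  obtain ⟨P, hP, x, -, rfl, -⟩ := exists_dist_eq_W2 μ μ
  have := dist_lineMap_lineMap_sq (Lp.const 2 P c) x x a 0
  rw [AffineMap.lineMap_apply_zero] at this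
  rw [← law_lineMap_const, W2_law_dirac, W2_law_dirac, this]
  ring

theorem W2_dilate_sq_le (c : E d) {a b : ℝ} (μ ν : P2 d) :
    W2 (dilate c a μ) (dilate c b ν) ^ 2 ≤ a * b * W2 μ ν ^ 2 +
      a * (a - b) * W2 μ (diracP2 c) ^ 2 + b * (b - a) * W2 ν (diracP2 c) ^ 2 := by
  obtain ⟨P, hP, x, y, rfl, rfl, hd⟩ := exists_dist_eq_W2 μ ν
  rw [← hd, W2_law_dirac, W2_law_dirac, ← dist_lineMap_lineMap_sq, ← law_lineMap_const,
    ← law_lineMap_const]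
  exact pow_le_pow_left₀ (W2_nonneg _ _) (W2_law_le_dist _ _) 2

/-- Dilating the two marginals by different nonnegative factors changes the cost of every plan by
the same affine function, hence preserves optimality. -/
theorem W2_dilate_sq (c : E d) {a b : ℝ} (ha : 0 ≤ a) (hb : 0 ≤ b) (μ ν : P2 d) :
    W2 (dilate c a μ) (dilate c b ν) ^ 2 = a * b * W2 μ ν ^ 2 +
      a * (a - b) * W2 μ (diracP2 c) ^ 2 + b * (b - a) * W2 ν (diracP2 c) ^ 2 := by
  rcases ha.eq_or_lt with rfl | ha
  · rw [dilate_zero, W2_comm, W2_dilate_dirac_sq]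
    ring
  rcases hb.eq_or_lt with rfl | hb
  · rw [dilate_zero, W2_dilate_dirac_sq]
    ring
  refine le_antisymm (W2_dilate_sq_le c μ ν) ?_
  have h := W2_dilate_sq_le c (a := a⁻¹) (b := b⁻¹) (dilate c a μ) (dilate c b ν)
  rw [dilate_inv_dilate c ha.ne', dilate_inv_dilate c hb.ne', W2_dilate_dirac_sq,
    W2_dilate_dirac_sq] at h
  have h' := mul_le_mul_of_nonneg_left h (mul_pos ha hb).le
  have e : a * b * (a⁻¹ * b⁻¹ * W2 (dilate c a μ) (dilate c b ν) ^ 2 +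
      a⁻¹ * (a⁻¹ - b⁻¹) * (a ^ 2 * W2 μ (diracP2 c) ^ 2) +
      b⁻¹ * (b⁻¹ - a⁻¹) * (b ^ 2 * W2 ν (diracP2 c) ^ 2)) =
      W2 (dilate c a μ) (dilate c b ν) ^ 2 + a * (b - a) * W2 μ (diracP2 c) ^ 2 +
        b * (a - b) * W2 ν (diracP2 c) ^ 2 := by
    field_simp
  rw [e] at h'
  linarith

/-! ### Mass and normalization -/

theorem mass_nonneg (μ : PosMeas d) : 0 ≤ mass μ := measureReal_nonneg

theorem mass_eq_zero_iff (μ : PosMeas d) : mass μ = 0 ↔ μ.1 = 0 := by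
  have := μ.2.1
  rw [mass, measureReal_eq_zero_iff, Measure.measure_univ_eq_zero]

theorem ofReal_mass_smul_normalized (x₀ : E d) (μ : PosMeas d) :
    ENNReal.ofReal (mass μ) • (normalized x₀ μ).1 = μ.1 := by
  have := μ.2.1
  by_cases h : μ.1 = 0
  · rw [(mass_eq_zero_iff μ).2 h, h]
    simp
  · have h0 : μ.1 Set.univ ≠ 0 := by simpa using h
    have e : (normalized x₀ μ).1 = (μ.1 Set.univ)⁻¹ • μ.1 := if_neg h
    rw [e, mass, ofReal_measureReal, smul_smul, ENNReal.mul_inv_cancel h0 (measure_ne_top _ _),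
      one_smul]

theorem mass_of_eq_smul {μ : PosMeas d} {m : ℝ} (hm : 0 ≤ m) {p : P2 d}
    (h : μ.1 = ENNReal.ofReal m • p.1) : mass μ = m := by
  have := p.2.1
  rw [mass, h, measureReal_ennreal_smul_apply, ENNReal.toReal_ofReal hm]
  simp

theorem normalized_of_eq_smul (x₀ : E d) {μ : PosMeas d} {m : ℝ} (hm : 0 < m) {p : P2 d}
    (h : μ.1 = ENNReal.ofReal m • p.1) : normalized x₀ μ = p := by
  have := p.2.1
  have hne : μ.1 ≠ 0 := by
    rw [Ne, ← mass_eq_zero_iff, mass_of_eq_smul hm.le h]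
    exact hm.ne'
  refine Subtype.ext ((if_neg hne).trans ?_)
  rw [h, Measure.smul_apply, measure_univ, smul_eq_mul, mul_one, smul_smul,
    ENNReal.inv_mul_cancel (by simpa using hm) ENNReal.ofReal_ne_top, one_smul]

theorem normalized_eq_normalized (x₀ y₀ : E d) {μ : PosMeas d} (h : 0 < mass μ) :
    normalized x₀ μ = normalized y₀ μ :=
  normalized_of_eq_smul x₀ h (ofReal_mass_smul_normalized y₀ μ).symm

noncomputable section

/-- The measure `(T_m)_# μ̄` with `m` the mass of `μ`.  Together with the mass it embeds the space of
positive measures into the `ℓ²` product of `ℝ` and the Wasserstein space. -/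
def spatialPart (x₀ : E d) (μ : PosMeas d) : P2 d := dilate x₀ (mass μ) (normalized x₀ μ)

end

theorem WOP_sq (x₀ : E d) (μ ν : PosMeas d) :
    WOP x₀ μ ν ^ 2 = |mass μ - mass ν| ^ 2 + W2 (spatialPart x₀ μ) (spatialPart x₀ ν) ^ 2 := by
  rw [sq_abs]
  exact Real.sq_sqrt (by positivity)

theorem WOP_nonneg (x₀ : E d) (μ ν : PosMeas d) : 0 ≤ WOP x₀ μ ν := Real.sqrt_nonneg _

theorem spatialPart_of_eq_smul (x₀ : E d) {μ : PosMeas d} {m : ℝ} (hm : 0 ≤ m) {p : P2 d}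
    (h : μ.1 = ENNReal.ofReal m • p.1) : spatialPart x₀ μ = dilate x₀ m p := by
  rw [spatialPart, mass_of_eq_smul hm h]
  rcases hm.eq_or_lt with rfl | hm
  · rw [dilate_zero, dilate_zero]
  · rw [normalized_of_eq_smul x₀ hm h]

theorem eq_of_mass_eq_of_spatialPart_eq (x₀ : E d) {μ ν : PosMeas d} (hm : mass μ = mass ν)
    (h : spatialPart x₀ μ = spatialPart x₀ ν) : μ = ν := by
  refine Subtype.ext ?_
  by_cases h0 : mass μ = 0
  · rw [(mass_eq_zero_iff μ).1 h0, (mass_eq_zero_iff ν).1 (hm ▸ h0)]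
  · have e : normalized x₀ μ = normalized x₀ ν := by
      rw [← dilate_inv_dilate x₀ h0 (normalized x₀ μ), ← dilate_inv_dilate x₀ h0 (normalized x₀ ν)]
      congr 1
      rw [spatialPart, spatialPart, ← hm] at h
      exact h
    rw [← ofReal_mass_smul_normalized x₀ μ, ← ofReal_mass_smul_normalized x₀ ν, hm, e]

/-! ### Geodesics of an `ℓ²` product -/

/-- Cauchy–Schwarz in the plane. -/
theorem mul_add_mul_le_of_sq {a₁ b₁ c₁ a₂ b₂ c₂ : ℝ} (hc₁ : 0 ≤ c₁) (hc₂ : 0 ≤ c₂)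
    (h₁ : c₁ ^ 2 = a₁ ^ 2 + b₁ ^ 2) (h₂ : c₂ ^ 2 = a₂ ^ 2 + b₂ ^ 2) :
    a₁ * a₂ + b₁ * b₂ ≤ c₁ * c₂ := by
  refine le_of_sq_le_sq ?_ (mul_nonneg hc₁ hc₂)
  rw [mul_pow, h₁, h₂]
  nlinarith [sq_nonneg (a₁ * b₂ - b₁ * a₂)]

section

variable {X : Type*} {D D₁ D₂ : X → X → ℝ}

theorem triangle_of_sq_eq_add (hD : ∀ x y, 0 ≤ D x y)
    (hsq : ∀ x y, D x y ^ 2 = D₁ x y ^ 2 + D₂ x y ^ 2) (h₁ : ∀ x y, 0 ≤ D₁ x y)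
    (h₂ : ∀ x y, 0 ≤ D₂ x y) (t₁ : ∀ x y z, D₁ x z ≤ D₁ x y + D₁ y z)
    (t₂ : ∀ x y z, D₂ x z ≤ D₂ x y + D₂ y z) (x y z : X) : D x z ≤ D x y + D y z := by
  refine le_of_sq_le_sq ?_ (add_nonneg (hD _ _) (hD _ _))
  have e₁ := pow_le_pow_left₀ (h₁ x z) (t₁ x y z) 2
  have e₂ := pow_le_pow_left₀ (h₂ x z) (t₂ x y z) 2
  have e := mul_add_mul_le_of_sq (hD x y) (hD y z) (hsq x y) (hsq y z)
  rw [hsq]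
  nlinarith [hsq x y, hsq y z]

/-- Both components of a geodesic in an `ℓ²` product have constant speed: the three pieces into
which two intermediate times divide it saturate Minkowski's inequality, hence are parallel to the
whole. -/
theorem IsGeodesic.of_sq_eq_add (hD : ∀ x y, 0 ≤ D x y)
    (hsq : ∀ x y, D x y ^ 2 = D₁ x y ^ 2 + D₂ x y ^ 2) (h₁ : ∀ x y, 0 ≤ D₁ x y)
    (h₂ : ∀ x y, 0 ≤ D₂ x y) (s₁ : ∀ x y, D₁ x y = D₁ y x) (s₂ : ∀ x y, D₂ x y = D₂ y x)
    (t₁ : ∀ x y z, D₁ x z ≤ D₁ x y + D₁ y z) (t₂ : ∀ x y z, D₂ x z ≤ D₂ x y + D₂ y z)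
    {x y : X} {σ : ℝ → X} (hσ : IsGeodesic D x y σ) {s t : ℝ} (hs : s ∈ Set.Icc (0 : ℝ) 1)
    (ht : t ∈ Set.Icc (0 : ℝ) 1) :
    D₁ (σ s) (σ t) = |t - s| * D₁ x y ∧ D₂ (σ s) (σ t) = |t - s| * D₂ x y := by
  wlog hst : s ≤ t generalizing s t
  · rw [s₁, s₂, abs_sub_comm]
    exact this ht hs (le_of_not_ge hst)
  have hc : ∀ u ∈ Set.Icc (0 : ℝ) 1, ∀ v ∈ Set.Icc (0 : ℝ) 1, u ≤ v →
      D₁ (σ u) (σ v) * D₁ x y + D₂ (σ u) (σ v) * D₂ x y ≤ (v - u) * D x y ^ 2 := by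
    intro u hu v hv huv
    have := mul_add_mul_le_of_sq (hD _ _) (hD _ _) (hsq (σ u) (σ v)) (hsq x y)
    rwa [hσ.dist_eq u hu v hv, abs_of_nonneg (by linarith), mul_assoc, ← sq] at this
  have c1 := hc 0 (by simp) s hs hs.1
  have c2 := hc s hs t ht hst
  have c3 := hc t ht 1 (by simp) ht.2
  rw [hσ.left] at c1
  rw [hσ.right] at c3
  have a₁ : D₁ x y ≤ D₁ x (σ s) + D₁ (σ s) (σ t) + D₁ (σ t) y := by
    linarith [t₁ x (σ s) y, t₁ (σ s) (σ t) y]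
  have a₂ : D₂ x y ≤ D₂ x (σ s) + D₂ (σ s) (σ t) + D₂ (σ t) y := by
    linarith [t₂ x (σ s) y, t₂ (σ s) (σ t) y]
  have b₁ := mul_le_mul_of_nonneg_right a₁ (h₁ x y)
  have b₂ := mul_le_mul_of_nonneg_right a₂ (h₂ x y)
  have hlen := hsq (σ s) (σ t)
  rw [hσ.dist_eq s hs t ht, mul_pow, sq_abs] at hlen
  rw [abs_of_nonneg (by linarith : (0 : ℝ) ≤ t - s)]
  have hxy := hsq x y
  have key : (D₁ (σ s) (σ t) - (t - s) * D₁ x y) ^ 2 +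
      (D₂ (σ s) (σ t) - (t - s) * D₂ x y) ^ 2 ≤ 0 := by
    have c2' : (t - s) * D x y ^ 2 ≤ D₁ (σ s) (σ t) * D₁ x y + D₂ (σ s) (σ t) * D₂ x y := by
      nlinarith
    have := mul_le_mul_of_nonneg_left c2' (by linarith : (0 : ℝ) ≤ t - s)
    nlinarith
  constructor
  · nlinarith [sq_nonneg (D₁ (σ s) (σ t) - (t - s) * D₁ x y),
      sq_nonneg (D₂ (σ s) (σ t) - (t - s) * D₂ x y)]
  · nlinarith [sq_nonneg (D₁ (σ s) (σ t) - (t - s) * D₁ x y),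
      sq_nonneg (D₂ (σ s) (σ t) - (t - s) * D₂ x y)]

end

/-! ### The metric `WOP` and its geodesics -/

theorem WOP_triangle (x₀ : E d) (μ ν ρ : PosMeas d) :
    WOP x₀ μ ρ ≤ WOP x₀ μ ν + WOP x₀ ν ρ :=
  triangle_of_sq_eq_add (WOP_nonneg x₀) (WOP_sq x₀) (fun _ _ => abs_nonneg _)
    (fun _ _ => W2_nonneg _ _) (fun _ _ _ => abs_sub_le _ _ _) (fun _ _ _ => W2_triangle _ _ _)
    μ ν ρ

theorem isMetric_WOP (x₀ : E d) : IsMetric (WOP x₀) where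
  eq_zero_iff μ ν := by
    constructor
    · intro h
      have hsq := WOP_sq x₀ μ ν
      rw [h] at hsq
      have h1 : |mass μ - mass ν| = 0 := by
        nlinarith [sq_nonneg |mass μ - mass ν|,
          sq_nonneg (W2 (spatialPart x₀ μ) (spatialPart x₀ ν))]
      have h2 : W2 (spatialPart x₀ μ) (spatialPart x₀ ν) = 0 := by
        nlinarith [sq_nonneg |mass μ - mass ν|,
          sq_nonneg (W2 (spatialPart x₀ μ) (spatialPart x₀ ν))]
      exact eq_of_mass_eq_of_spatialPart_eq x₀ (sub_eq_zero.1 (abs_eq_zero.1 h1))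
        ((W2_eq_zero_iff _ _).1 h2)
    · rintro rfl
      have hsq := WOP_sq x₀ μ μ
      rw [W2_self, sub_self] at hsq
      simpa using hsq
  symm μ ν := by
    rw [WOP, WOP, W2_comm, sub_sq_comm]
  triangle := WOP_triangle x₀

section

variable {x₀ : E d} {μ₀ μ₁ : PosMeas d} {σ : ℝ → PosMeas d}

/-- Masses and spatial parts both move with constant speed. -/
theorem IsGeodesic.components (h : IsGeodesic (WOP x₀) μ₀ μ₁ σ) {s t : ℝ}
    (hs : s ∈ Set.Icc (0 : ℝ) 1) (ht : t ∈ Set.Icc (0 : ℝ) 1) :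
    |mass (σ s) - mass (σ t)| = |t - s| * |mass μ₀ - mass μ₁| ∧
      W2 (spatialPart x₀ (σ s)) (spatialPart x₀ (σ t)) =
        |t - s| * W2 (spatialPart x₀ μ₀) (spatialPart x₀ μ₁) :=
  IsGeodesic.of_sq_eq_add (D₁ := fun μ ν => |mass μ - mass ν|)
    (D₂ := fun μ ν => W2 (spatialPart x₀ μ) (spatialPart x₀ ν)) (WOP_nonneg x₀) (WOP_sq x₀)
    (fun _ _ => abs_nonneg _) (fun _ _ => W2_nonneg _ _) (fun _ _ => abs_sub_comm _ _)
    (fun _ _ => W2_comm _ _) (fun _ _ _ => abs_sub_le _ _ _) (fun _ _ _ => W2_triangle _ _ _)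
    h hs ht

theorem IsGeodesic.spatialPart (h : IsGeodesic (WOP x₀) μ₀ μ₁ σ) :
    IsGeodesic W2 (spatialPart x₀ μ₀) (spatialPart x₀ μ₁) fun t => spatialPart x₀ (σ t) where
  left := congrArg _ h.left
  right := congrArg _ h.right
  dist_eq _ hs _ ht := (h.components hs ht).2

theorem IsGeodesic.mass_eq (h : IsGeodesic (WOP x₀) μ₀ μ₁ σ) {t : ℝ}
    (ht : t ∈ Set.Icc (0 : ℝ) 1) : mass (σ t) = interpMass (mass μ₀) (mass μ₁) t := by
  have h0 := (h.components (s := 0) (by simp) ht).1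
  have h1 := (h.components (t := 1) ht (by simp)).1
  rw [h.left, sub_zero, abs_of_nonneg ht.1] at h0
  rw [h.right, abs_of_nonneg (sub_nonneg.2 ht.2)] at h1
  have e0 : dist (mass μ₀) (mass (σ t)) = t * dist (mass μ₀) (mass μ₁) := h0
  have e1 : dist (mass (σ t)) (mass μ₁) = (1 - t) * dist (mass μ₀) (mass μ₁) := h1
  rw [eq_lineMap_of_dist_eq_mul_of_dist_eq_mul e0 e1, AffineMap.lineMap_apply_module, interpMass,
    smul_eq_mul, smul_eq_mul]

end

section

variable {m₀ m₁ t : ℝ}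

theorem interpMass_nonneg (h₀ : 0 ≤ m₀) (h₁ : 0 ≤ m₁) (ht : t ∈ Set.Icc (0 : ℝ) 1) :
    0 ≤ interpMass m₀ m₁ t :=
  add_nonneg (mul_nonneg (sub_nonneg.2 ht.2) h₀) (mul_nonneg ht.1 h₁)

theorem timeChange_mem (h₀ : 0 ≤ m₀) (h₁ : 0 ≤ m₁) (ht : t ∈ Set.Icc (0 : ℝ) 1) :
    timeChange m₀ m₁ t ∈ Set.Icc (0 : ℝ) 1 := by
  refine ⟨div_nonneg (mul_nonneg ht.1 h₁) (interpMass_nonneg h₀ h₁ ht),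
    div_le_one_of_le₀ ?_ (interpMass_nonneg h₀ h₁ ht)⟩
  have := mul_nonneg (sub_nonneg.2 ht.2) h₀
  rw [interpMass]
  linarith

/-- This also holds when the interpolated mass vanishes, since then `t * m₁ = 0`. -/
theorem interpMass_mul_timeChange (h₀ : 0 ≤ m₀) (h₁ : 0 ≤ m₁) (ht : t ∈ Set.Icc (0 : ℝ) 1) :
    interpMass m₀ m₁ t * timeChange m₀ m₁ t = t * m₁ := by
  rcases (interpMass_nonneg h₀ h₁ ht).eq_or_lt with h | h
  · have := mul_nonneg (sub_nonneg.2 ht.2) h₀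
    have := mul_nonneg ht.1 h₁
    rw [← h, zero_mul]
    rw [interpMass] at h
    linarith
  · exact mul_div_cancel₀ _ h.ne'

end

/-- The normalizations along a `WOP` geodesic have the mutual distances of a reparametrized
Wasserstein geodesic.  The distances between the spatial parts are known, and so are the second
moments along a Wasserstein geodesic; undoing the dilations gives the distances between the
normalizations. -/
theorem IsGeodesic.W2_normalized {x₀ : E d} {μ₀ μ₁ : PosMeas d} {σ : ℝ → PosMeas d}
    (h : IsGeodesic (WOP x₀) μ₀ μ₁ σ) {s t : ℝ} (hs : s ∈ Set.Icc (0 : ℝ) 1)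
    (ht : t ∈ Set.Icc (0 : ℝ) 1) (hms : 0 < interpMass (mass μ₀) (mass μ₁) s)
    (hmt : 0 < interpMass (mass μ₀) (mass μ₁) t) :
    W2 (normalized x₀ (σ s)) (normalized x₀ (σ t)) =
      |timeChange (mass μ₀) (mass μ₁) t - timeChange (mass μ₀) (mass μ₁) s| *
        W2 (normalized x₀ μ₀) (normalized x₀ μ₁) := by
  have hst := h.spatialPart.dist_eq s hs t ht
  have hvs := h.spatialPart.W2_dirac_sq hs x₀
  have hvt := h.spatialPart.W2_dirac_sq ht x₀
  have hst2 := congrArg (· ^ 2) hst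
  simp only [mul_pow, sq_abs] at hst2
  simp only [WOPGeom.spatialPart, h.mass_eq hs, h.mass_eq ht] at hst2 hvs hvt
  simp only [W2_dilate_sq x₀ hms.le hmt.le, W2_dilate_sq x₀ (mass_nonneg μ₀) (mass_nonneg μ₁),
    W2_dilate_dirac_sq] at hst2 hvs hvt
  have hc : ∀ a b : ℝ, 0 ≤ a → 0 ≤ b → a ^ 2 = b ^ 2 → a = b := fun a b ha hb hab =>
    (pow_left_inj₀ ha hb two_ne_zero).1 hab
  refine hc _ _ (W2_nonneg _ _) (mul_nonneg (abs_nonneg _) (W2_nonneg _ _)) ?_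
  rw [mul_pow, sq_abs, timeChange, timeChange]
  generalize W2 (normalized x₀ (σ s)) (normalized x₀ (σ t)) ^ 2 = w at *
  generalize W2 (normalized x₀ (σ s)) (diracP2 x₀) ^ 2 = vs at *
  generalize W2 (normalized x₀ (σ t)) (diracP2 x₀) ^ 2 = vt at *
  generalize W2 (normalized x₀ μ₀) (diracP2 x₀) ^ 2 = v₀ at *
  generalize W2 (normalized x₀ μ₁) (diracP2 x₀) ^ 2 = v₁ at *
  generalize W2 (normalized x₀ μ₀) (normalized x₀ μ₁) ^ 2 = W at *
  generalize mass μ₀ = m₀ at *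
  generalize mass μ₁ = m₁ at *
  clear hst h hc hs ht
  have hms' := hms.ne'
  have hmt' := hmt.ne'
  generalize hM : interpMass m₀ m₁ s = M at *
  generalize hN : interpMass m₀ m₁ t = N at *
  -- The unknown second moments and the unknown distance are rational functions of the data.
  have evs : vs = ((1 - s) * (m₀ ^ 2 * v₀) + s * (m₁ ^ 2 * v₁) - s * (1 - s) *
      (m₀ * m₁ * W + m₀ * (m₀ - m₁) * v₀ + m₁ * (m₁ - m₀) * v₁)) / M ^ 2 := by
    rw [eq_div_iff (by positivity)]; linarith
  have evt : vt = ((1 - t) * (m₀ ^ 2 * v₀) + t * (m₁ ^ 2 * v₁) - t * (1 - t) *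
      (m₀ * m₁ * W + m₀ * (m₀ - m₁) * v₀ + m₁ * (m₁ - m₀) * v₁)) / N ^ 2 := by
    rw [eq_div_iff (by positivity)]; linarith
  have ew : w = ((t - s) ^ 2 * (m₀ * m₁ * W + m₀ * (m₀ - m₁) * v₀ + m₁ * (m₁ - m₀) * v₁) -
      M * (M - N) * vs - N * (N - M) * vt) / (M * N) := by
    rw [eq_div_iff (by positivity)]; linarith
  rw [ew, evs, evt]
  field_simp
  rw [← hM, ← hN, interpMass, interpMass]
  ring

section

variable (x₀ : E d) {μ₀ μ₁ : PosMeas d} {σ : ℝ → PosMeas d} {μhat : ℝ → P2 d}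

/-- Reparametrizing a Wasserstein geodesic between the normalizations, and weighting it by the
interpolated mass, gives a `WOP` geodesic. -/
theorem isGeodesic_WOP_of_isGeodesic_W2
    (h : IsGeodesic W2 (normalized x₀ μ₀) (normalized x₀ μ₁) μhat)
    (hσ : ∀ t ∈ Set.Icc (0 : ℝ) 1, (σ t).1 = ENNReal.ofReal (interpMass (mass μ₀) (mass μ₁) t) •
      (μhat (timeChange (mass μ₀) (mass μ₁) t)).1) :
    IsGeodesic (WOP x₀) μ₀ μ₁ σ where
  left := by
    refine Subtype.ext ((hσ 0 (by simp)).trans ?_)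
    have e1 : interpMass (mass μ₀) (mass μ₁) 0 = mass μ₀ := by simp [interpMass]
    have e2 : timeChange (mass μ₀) (mass μ₁) 0 = 0 := by simp [timeChange]
    rw [e1, e2, h.left, ofReal_mass_smul_normalized]
  right := by
    refine Subtype.ext ((hσ 1 (by simp)).trans ?_)
    have e1 : interpMass (mass μ₀) (mass μ₁) 1 = mass μ₁ := by simp [interpMass]
    rw [e1]
    by_cases hm : mass μ₁ = 0
    · rw [hm, (mass_eq_zero_iff μ₁).1 hm]
      simp
    · have e2 : timeChange (mass μ₀) (mass μ₁) 1 = 1 := by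
        rw [timeChange, e1, one_mul, div_self hm]
      rw [e2, h.right, ofReal_mass_smul_normalized]
  dist_eq s hs t ht := by
    have hms := interpMass_nonneg (mass_nonneg μ₀) (mass_nonneg μ₁) hs
    have hmt := interpMass_nonneg (mass_nonneg μ₀) (mass_nonneg μ₁) ht
    have hls := timeChange_mem (mass_nonneg μ₀) (mass_nonneg μ₁) hs
    have hlt := timeChange_mem (mass_nonneg μ₀) (mass_nonneg μ₁) ht
    have es := interpMass_mul_timeChange (mass_nonneg μ₀) (mass_nonneg μ₁) hs
    have et := interpMass_mul_timeChange (mass_nonneg μ₀) (mass_nonneg μ₁) ht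
    refine (pow_left_inj₀ (WOP_nonneg _ _ _)
      (mul_nonneg (abs_nonneg _) (WOP_nonneg _ _ _)) two_ne_zero).1 ?_
    rw [mul_pow, WOP_sq, WOP_sq, sq_abs, sq_abs, sq_abs, mass_of_eq_smul hms (hσ s hs),
      mass_of_eq_smul hmt (hσ t ht), spatialPart_of_eq_smul x₀ hms (hσ s hs),
      spatialPart_of_eq_smul x₀ hmt (hσ t ht), spatialPart, spatialPart, W2_dilate_sq x₀ hms hmt,
      W2_dilate_sq x₀ (mass_nonneg μ₀) (mass_nonneg μ₁), h.dist_eq _ hls _ hlt,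
      h.W2_dirac_sq hls, h.W2_dirac_sq hlt, mul_pow, sq_abs]
    generalize W2 (normalized x₀ μ₀) (diracP2 x₀) ^ 2 = v₀
    generalize W2 (normalized x₀ μ₁) (diracP2 x₀) ^ 2 = v₁
    generalize W2 (normalized x₀ μ₀) (normalized x₀ μ₁) ^ 2 = W
    generalize timeChange (mass μ₀) (mass μ₁) s = l at *
    generalize timeChange (mass μ₀) (mass μ₁) t = k at *
    generalize mass μ₀ = m₀ at *
    generalize mass μ₁ = m₁ at *
    rw [interpMass] at es et
    rw [interpMass, interpMass]
    -- With `D = M l - N k = (s - t) m₁` for the masses `M`, `N` at the two times, the coefficient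
    -- of `W` is `D ^ 2 - (M - N) D` and that of `v₁ - v₀` is `(M - N) D`.
    linear_combination ((((1 - s) * m₀ + s * m₁) - ((1 - t) * m₀ + t * m₁)) * (v₁ - v₀ - W) +
      W * (((1 - s) * m₀ + s * m₁) * l - ((1 - t) * m₀ + t * m₁) * k + (s - t) * m₁)) * (es - et)

/-- `timeChange` is a bijection of the unit interval when both masses are positive; the inverse
exchanges the masses. -/
theorem timeChange_inverse {m₀ m₁ t : ℝ} (h₀ : 0 < m₀) (h₁ : 0 < m₁)
    (ht : t ∈ Set.Icc (0 : ℝ) 1) : timeChange m₀ m₁ (timeChange m₁ m₀ t) = t := by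
  have hp : 0 < (1 - t) * m₁ + t * m₀ := by
    rcases ht.1.eq_or_lt with rfl | h
    · linarith
    · have := mul_pos h h₀
      have := mul_nonneg (sub_nonneg.2 ht.2) h₁.le
      linarith
  have hp' := hp.ne'
  have e : interpMass m₀ m₁ (timeChange m₁ m₀ t) = m₀ * m₁ / ((1 - t) * m₁ + t * m₀) := by
    rw [interpMass, timeChange, interpMass]
    field_simp
    ring
  rw [timeChange, e, timeChange, interpMass]
  field_simp

theorem interpMass_pos {m₀ m₁ t : ℝ} (h₀ : 0 < m₀) (h₁ : 0 < m₁)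
    (ht : t ∈ Set.Icc (0 : ℝ) 1) : 0 < interpMass m₀ m₁ t := by
  rw [interpMass]
  rcases ht.1.eq_or_lt with rfl | h
  · linarith
  · have := mul_pos h h₁
    have := mul_nonneg (sub_nonneg.2 ht.2) h₀.le
    linarith

/-- If both masses are positive, the normalizations along the `WOP` geodesic form a Wasserstein
geodesic after the inverse time change.  If an endpoint is zero, the path is a multiple of the other
endpoint, and any Wasserstein geodesic will do. -/
theorem exists_isGeodesic_W2_of_isGeodesic_WOP (h : IsGeodesic (WOP x₀) μ₀ μ₁ σ) :
    ∃ μhat : ℝ → P2 d, IsGeodesic W2 (normalized x₀ μ₀) (normalized x₀ μ₁) μhat ∧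
      ∀ t ∈ Set.Icc (0 : ℝ) 1, (σ t).1 =
        ENNReal.ofReal (interpMass (mass μ₀) (mass μ₁) t) •
          (μhat (timeChange (mass μ₀) (mass μ₁) t)).1 := by
  have hn₀ := mass_nonneg μ₀
  have hn₁ := mass_nonneg μ₁
  -- It suffices to identify the normalization of `σ t` when the interpolated mass is positive.
  have suff : ∀ μhat : ℝ → P2 d, (∀ t ∈ Set.Icc (0 : ℝ) 1,
      0 < interpMass (mass μ₀) (mass μ₁) t →
        μhat (timeChange (mass μ₀) (mass μ₁) t) = normalized x₀ (σ t)) →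
      ∀ t ∈ Set.Icc (0 : ℝ) 1, (σ t).1 =
        ENNReal.ofReal (interpMass (mass μ₀) (mass μ₁) t) •
          (μhat (timeChange (mass μ₀) (mass μ₁) t)).1 := by
    intro μhat hμ t ht
    rcases (interpMass_nonneg hn₀ hn₁ ht).eq_or_lt with h0 | h0
    · rw [← h0, (mass_eq_zero_iff (σ t)).1 ((h.mass_eq ht).trans h0.symm)]
      simp
    · rw [hμ t ht h0, ← h.mass_eq ht, ofReal_mass_smul_normalized]
  by_cases hpos : 0 < mass μ₀ ∧ 0 < mass μ₁
  · obtain ⟨h₀, h₁⟩ := hpos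
    let μhat : ℝ → P2 d := fun s => normalized x₀ (σ (timeChange (mass μ₁) (mass μ₀) s))
    refine ⟨μhat, ⟨?_, ?_, ?_⟩, suff μhat fun t ht _ => ?_⟩
    · have : timeChange (mass μ₁) (mass μ₀) 0 = 0 := by simp [timeChange]
      simp only [μhat, this, h.left]
    · have : timeChange (mass μ₁) (mass μ₀) 1 = 1 := by simp [timeChange, interpMass, h₀.ne']
      simp only [μhat, this, h.right]
    · intro s hs t ht
      have hs' := timeChange_mem hn₁ hn₀ hs
      have ht' := timeChange_mem hn₁ hn₀ ht
      simp only [μhat]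
      rw [h.W2_normalized hs' ht' (interpMass_pos h₀ h₁ hs') (interpMass_pos h₀ h₁ ht'),
        timeChange_inverse h₀ h₁ hs, timeChange_inverse h₀ h₁ ht]
    · simp only [μhat, timeChange_inverse h₁ h₀ ht]
  · obtain ⟨μhat, hμ⟩ := exists_isGeodesic_W2 (normalized x₀ μ₀) (normalized x₀ μ₁)
    refine ⟨μhat, hμ, suff _ fun t ht hmt => ?_⟩
    -- One endpoint is zero, so for positive interpolated mass the normalization is that of the
    -- other endpoint.
    rcases hn₀.eq_or_lt with h₀ | h₀
    · have hmt' := hmt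
      rw [interpMass, ← h₀, mul_zero, zero_add] at hmt'
      have h₁ : 0 < mass μ₁ := pos_of_mul_pos_right hmt' ht.1
      have e : ∀ u, 0 < interpMass (mass μ₀) (mass μ₁) u →
          timeChange (mass μ₀) (mass μ₁) u = 1 := by
        intro u hu
        rw [interpMass, ← h₀, mul_zero, zero_add] at hu
        rw [timeChange, interpMass, ← h₀, mul_zero, zero_add, div_self hu.ne']
      have hm1 : 0 < interpMass (mass μ₀) (mass μ₁) 1 := by simpa [interpMass] using h₁
      have := h.W2_normalized ht (t := 1) (by simp) hmt hm1
      rw [e _ hmt, e _ hm1, sub_self, abs_zero, zero_mul, W2_eq_zero_iff, h.right] at this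
      rw [e _ hmt, hμ.right, this]
    · have h₁ : mass μ₁ = 0 := le_antisymm (not_lt.1 fun h₁ => hpos ⟨h₀, h₁⟩) hn₁
      have e : ∀ u, timeChange (mass μ₀) (mass μ₁) u = 0 := by simp [timeChange, h₁]
      have hm0 : 0 < interpMass (mass μ₀) (mass μ₁) 0 := by simpa [interpMass] using h₀
      have := h.W2_normalized (s := 0) (by simp) ht hm0 hmt
      rw [e, e, sub_self, abs_zero, zero_mul, W2_eq_zero_iff, h.left] at this
      rw [e, hμ.left, this]

theorem isGeodesic_WOP_iff : IsGeodesic (WOP x₀) μ₀ μ₁ σ ↔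
    ∃ μhat : ℝ → P2 d, IsGeodesic W2 (normalized x₀ μ₀) (normalized x₀ μ₁) μhat ∧
      ∀ t ∈ Set.Icc (0 : ℝ) 1, (σ t).1 =
        ENNReal.ofReal (interpMass (mass μ₀) (mass μ₁) t) •
          (μhat (timeChange (mass μ₀) (mass μ₁) t)).1 :=
  ⟨exists_isGeodesic_W2_of_isGeodesic_WOP x₀,
    fun ⟨_, h, hσ⟩ => isGeodesic_WOP_of_isGeodesic_W2 x₀ h hσ⟩

/-- Only the normalization of the zero measure depends on the reference point.  If an endpoint is
zero, the geodesic between the normalizations is used only at the other endpoint. -/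
theorem IsGeodesic.change_reference (y₀ : E d) (h : IsGeodesic (WOP x₀) μ₀ μ₁ σ) :
    IsGeodesic (WOP y₀) μ₀ μ₁ σ := by
  obtain ⟨μhat, hμ, hσ⟩ := exists_isGeodesic_W2_of_isGeodesic_WOP x₀ h
  have hn₀ := mass_nonneg μ₀
  have hn₁ := mass_nonneg μ₁
  by_cases hpos : 0 < mass μ₀ ∧ 0 < mass μ₁
  · rw [normalized_eq_normalized x₀ y₀ hpos.1, normalized_eq_normalized x₀ y₀ hpos.2] at hμ
    exact isGeodesic_WOP_of_isGeodesic_W2 y₀ hμ hσ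
  · obtain ⟨μhat', hμ'⟩ := exists_isGeodesic_W2 (normalized y₀ μ₀) (normalized y₀ μ₁)
    refine isGeodesic_WOP_of_isGeodesic_W2 y₀ hμ' fun t ht => ?_
    rw [hσ t ht]
    rcases (interpMass_nonneg hn₀ hn₁ ht).eq_or_lt with h0 | h0
    · rw [← h0]
      simp
    · congr 2
      rcases hn₀.eq_or_lt with h₀ | h₀
      · rw [interpMass, ← h₀, mul_zero, zero_add] at h0
        have e : timeChange (mass μ₀) (mass μ₁) t = 1 := by
          rw [timeChange, interpMass, ← h₀, mul_zero, zero_add, div_self h0.ne']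
        rw [e, hμ.right, hμ'.right,
          normalized_eq_normalized x₀ y₀ (pos_of_mul_pos_right h0 ht.1)]
      · have h₁ : mass μ₁ = 0 := le_antisymm (not_lt.1 fun h₁ => hpos ⟨h₀, h₁⟩) hn₁
        have e : timeChange (mass μ₀) (mass μ₁) t = 0 := by simp [timeChange, h₁]
        rw [e, hμ.left, hμ'.left, normalized_eq_normalized x₀ y₀ h₀]

theorem exists_isGeodesic_WOP (μ₀ μ₁ : PosMeas d) : ∃ σ, IsGeodesic (WOP x₀) μ₀ μ₁ σ := by
  obtain ⟨μhat, hμ⟩ := exists_isGeodesic_W2 (normalized x₀ μ₀) (normalized x₀ μ₁)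
  refine ⟨fun t => ⟨ENNReal.ofReal (interpMass (mass μ₀) (mass μ₁) t) •
    (μhat (timeChange (mass μ₀) (mass μ₁) t)).1, ?_, ?_⟩,
    isGeodesic_WOP_of_isGeodesic_W2 x₀ hμ fun t _ => rfl⟩
  · have := (μhat (timeChange (mass μ₀) (mass μ₁) t)).2.1
    exact Measure.smul_finite _ ENNReal.ofReal_ne_top
  · exact (μhat (timeChange (mass μ₀) (mass μ₁) t)).2.2.smul_measure ENNReal.ofReal_ne_top

/-- The comparison inequality for the spatial parts adds to the comparison equality for the masses,
which lie on a line. -/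
theorem WOP_comparison (h : IsGeodesic (WOP x₀) μ₀ μ₁ σ) (η : PosMeas d) {t : ℝ}
    (ht : t ∈ Set.Icc (0 : ℝ) 1) :
    (1 - t) * WOP x₀ μ₀ η ^ 2 + t * WOP x₀ μ₁ η ^ 2 - t * (1 - t) * WOP x₀ μ₀ μ₁ ^ 2 ≤
      WOP x₀ (σ t) η ^ 2 := by
  have hW := W2_comparison h.spatialPart ht (spatialPart x₀ η)
  simp only [WOP_sq, sq_abs, h.mass_eq ht, interpMass]
  linarith

end

end WOPGeom

theorem mainTheorem4 (d : ℕ) (x₀ : WOPGeom.E d) :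
    (∀ (μ₀ μ₁ : WOPGeom.PosMeas d) (σ : ℝ → WOPGeom.PosMeas d),
      WOPGeom.IsGeodesic (WOPGeom.WOP x₀) μ₀ μ₁ σ ↔
        ∃ μhat : ℝ → WOPGeom.P2 d,
          WOPGeom.IsGeodesic WOPGeom.W2 (WOPGeom.normalized x₀ μ₀) (WOPGeom.normalized x₀ μ₁)
            μhat ∧
          ∀ t ∈ Set.Icc (0 : ℝ) 1,
            (σ t).1 =
              ENNReal.ofReal (WOPGeom.interpMass (WOPGeom.mass μ₀) (WOPGeom.mass μ₁) t) •
                (μhat (WOPGeom.timeChange (WOPGeom.mass μ₀) (WOPGeom.mass μ₁) t)).1) ∧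
    (∀ (y₀ : WOPGeom.E d) (μ₀ μ₁ : WOPGeom.PosMeas d) (σ : ℝ → WOPGeom.PosMeas d),
      WOPGeom.IsGeodesic (WOPGeom.WOP x₀) μ₀ μ₁ σ ↔
        WOPGeom.IsGeodesic (WOPGeom.WOP y₀) μ₀ μ₁ σ) ∧
    WOPGeom.IsGeodesicSpace (WOPGeom.WOP x₀) ∧
    WOPGeom.IsNonnegativelyCurved (WOPGeom.WOP x₀) := by
  refine ⟨fun μ₀ μ₁ σ => WOPGeom.isGeodesic_WOP_iff x₀, fun y₀ μ₀ μ₁ σ =>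
    ⟨fun h => h.change_reference x₀ y₀, fun h => h.change_reference y₀ x₀⟩, ?_, ?_, ?_⟩
  · exact ⟨WOPGeom.isMetric_WOP x₀, WOPGeom.exists_isGeodesic_WOP x₀⟩
  · exact ⟨WOPGeom.isMetric_WOP x₀, WOPGeom.exists_isGeodesic_WOP x₀⟩
  · exact fun μ₀ μ₁ η σ h t ht => WOPGeom.WOP_comparison x₀ h η ht
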